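/- **Theorem 2.2 (First-order optimality condition).** Let $n\ge 1$ and let $\Omega\subset\mathbb R^n$ be a bounded open set (for instance, $n\in\{2,3\}$ and $\Omega$ a bounded convex domain with $C^{1,1}$ or polygonal boundary). Let $a_{ij},c_0\in L^\infty(\Omega)$, $1\le i,j\le n$, be such that $a_{ij}=a_{ji}$ and $c_0\ge 0$ a.e. in $\Omega$, and suppose that there is a constant $\theta>0$ with $$\sum_{i,j=1}^n a_{ij}(x)\xi_i\xi_j\ \ge\ \theta\|\xi\|^2\qquad\text{for a.a. }x\in\Omega\text{ and all }\xi\in\mathbb R^n .$$ Let $a\le 0\le b$, $\alpha>0$, $\beta>0$ be real numbers and let $y_d,y_r\in L^2(\Omega)$. Let $H^1_0(\Omega)$ be the closure of $C_c^\infty(\Omega)$ in the $H^1$-norm, let $H^{-1}(\Omega)$ be its dual, and on $H^1_0(\Omega)$ put $$a(y,v)=\int_\Omega\Big(\sum_{i,j=1}^n a_{ij}\,y_{x_i}v_{x_j}+c_0\,y\,v\Big)\,dx .$$ Put $U_{ad}=\{u\in L^2(\Omega): a\le u\le b\ \text{a.e. on }\Omega\}$, and consider the problem (P) of minimizing $$J(y,u)=\tfrac12\|y-y_d\|_{L^2(\Omega)}^2+\tfrac{\alpha}{2}\|u\|_{L^2(\Omega)}^2+\beta\|u\|_{L^1(\Omega)}$$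 over all $(y,u)\in H^1_0(\Omega)\times L^2(\Omega)$ with $u\in U_{ad}$ and $a(y,v)=(u+y_r,v)_{L^2(\Omega)}$ for all $v\in H^1_0(\Omega)$. Then the operator $H^1_0(\Omega)\to H^{-1}(\Omega)$, $y\mapsto a(y,\cdot)$, has a bounded inverse $\mathcal S:H^{-1}(\Omega)\to H^1_0(\Omega)$. Let $\mathcal S^*:H^{-1}(\Omega)\to H^1_0(\Omega)$ be its adjoint, that is, $g(\mathcal S^*f)=f(\mathcal S g)$ for all $f,g\in H^{-1}(\Omega)$, and regard $L^2(\Omega)$ as a subset of $H^{-1}(\Omega)$ through $f\mapsto (f,\cdot)_{L^2(\Omega)}$. A pair $(y^*,u^*)\in H^1_0(\Omega)\times L^2(\Omega)$ is an optimal solution of (P) if and only if $u^*\in U_{ad}$ and there exists an adjoint state $p^*\in H^1_0(\Omega)$ such that $$y^*=\mathcal S(u^*+y_r),\qquad p^*=\mathcal S^*(y_d-y^*),$$ $$\langle\alpha u^*-p^*,\,u-u^*\rangle_{L^2(\Omega)}+\beta\big(\|u\|_{L^1(\Omega)}-\|u^*\|_{L^1(\Omega)}\big)\ \ge\ 0\qquad\text{for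 all }u\in U_{ad}.$$ -/

import Mathlib

open MeasureTheory
open scoped ENNReal ContDiff

noncomputable section

namespace EllipticControl

variable {n : ℕ}

/-- The real Hilbert space `L²(Ω)`. -/
abbrev L2 (Ω : Set (EuclideanSpace ℝ (Fin n))) : Type :=
  Lp ℝ 2 (volume.restrict Ω)

/-- The space `L^∞(Ω)`. -/
abbrev Linf (Ω : Set (EuclideanSpace ℝ (Fin n))) : Type :=
  Lp ℝ ∞ (volume.restrict Ω)

/-- The classical partial derivative `∂φ/∂x_i`. -/
def partialDeriv (i : Fin n) (φ : EuclideanSpace ℝ (Fin n) → ℝ) :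
    EuclideanSpace ℝ (Fin n) → ℝ :=
  fun x => fderiv ℝ φ x (EuclideanSpace.single i 1)

/-- `φ ∈ C_c^∞(Ω)`. -/
structure IsTestFunction (Ω : Set (EuclideanSpace ℝ (Fin n)))
    (φ : EuclideanSpace ℝ (Fin n) → ℝ) : Prop where
  smooth : ContDiff ℝ ∞ φ
  compact : HasCompactSupport φ
  subset : tsupport φ ⊆ Ω

/-- The Hilbert space `L²(Ω) × L²(Ω)ⁿ` of pairs `(y, g)`, with the norm
`(‖y‖² + ∑ i, ‖g i‖²)^(1/2)`.  A Sobolev function `y` is represented in it by the pair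
`(y, ∇y)`, so that the norm is the `H¹`-norm. -/
abbrev Pairs (Ω : Set (EuclideanSpace ℝ (Fin n))) : Type :=
  WithLp 2 (L2 Ω × PiLp 2 (fun _ : Fin n => L2 Ω))

/-- The space of pairs `(φ, ∇φ)` with `φ ∈ C_c^∞(Ω)`. -/
def testPairs (Ω : Set (EuclideanSpace ℝ (Fin n))) : Submodule ℝ (Pairs Ω) where
  carrier := {w | ∃ φ, IsTestFunction Ω φ ∧ w.fst =ᵐ[volume.restrict Ω] φ ∧
    ∀ i, w.snd i =ᵐ[volume.restrict Ω] partialDeriv i φ}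
  zero_mem' := by
    refine ⟨0, ⟨contDiff_const, HasCompactSupport.zero, by simp⟩, ?_, fun i => ?_⟩
    · exact Lp.coeFn_zero _ _ _
    · have h0 : partialDeriv i (0 : EuclideanSpace ℝ (Fin n) → ℝ) = 0 := by
        funext x; simp [partialDeriv]
      rw [h0]
      exact Lp.coeFn_zero _ _ _
  add_mem' := by
    rintro v w ⟨φ, hφ, hv, hv'⟩ ⟨ψ, hψ, hw, hw'⟩
    refine ⟨φ + ψ, ⟨hφ.smooth.add hψ.smooth, hφ.compact.add hψ.compact,
      (tsupport_add φ ψ).trans (Set.union_subset hφ.subset hψ.subset)⟩, ?_, fun i => ?_⟩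
    · exact (Lp.coeFn_add _ _).trans (hv.add hw)
    · have h0 : partialDeriv i (φ + ψ) = partialDeriv i φ + partialDeriv i ψ := by
        funext x
        simp only [partialDeriv, Pi.add_apply]
        rw [fderiv_add (hφ.smooth.differentiable (by simp) x)
          (hψ.smooth.differentiable (by simp) x)]
        rfl
      rw [h0]
      exact (Lp.coeFn_add _ _).trans ((hv' i).add (hw' i))
  smul_mem' := by
    rintro c w ⟨φ, hφ, hw, hw'⟩
    refine ⟨c • φ, ⟨hφ.smooth.const_smul c, hφ.compact.smul_left (f := fun _ => c),
      (tsupport_smul_subset_right (fun _ => c) φ).trans hφ.subset⟩, ?_, fun i => ?_⟩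
    · exact (Lp.coeFn_smul _ _).trans (hw.const_smul c)
    · have h0 : partialDeriv i (c • φ) = c • partialDeriv i φ := by
        funext x
        simp only [partialDeriv, Pi.smul_apply]
        rw [fderiv_const_smul (hφ.smooth.differentiable (by simp) x)]
        rfl
      rw [h0]
      exact (Lp.coeFn_smul _ _).trans ((hw' i).const_smul c)

/-- The Sobolev space `H¹₀(Ω)`: the closure of `C_c^∞(Ω)` in the `H¹`-norm. -/
def H10 (Ω : Set (EuclideanSpace ℝ (Fin n))) : Submodule ℝ (Pairs Ω) :=
  (testPairs Ω).topologicalClosure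

instance (Ω : Set (EuclideanSpace ℝ (Fin n))) : CompleteSpace (H10 Ω) :=
  inferInstanceAs (CompleteSpace (testPairs Ω).topologicalClosure)

/-- `H⁻¹(Ω)`, the dual space of `H¹₀(Ω)`. -/
abbrev Hm1 (Ω : Set (EuclideanSpace ℝ (Fin n))) : Type := StrongDual ℝ (H10 Ω)

/-- The embedding `H¹₀(Ω) → L²(Ω)`. -/
def toL2 (Ω : Set (EuclideanSpace ℝ (Fin n))) : H10 Ω →L[ℝ] L2 Ω :=
  (WithLp.fstL 2 ℝ (L2 Ω) (PiLp 2 (fun _ : Fin n => L2 Ω))) ∘L (H10 Ω).subtypeL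

/-- The weak partial derivative `y ↦ y_{x_i}`, `H¹₀(Ω) → L²(Ω)`. -/
def weakDeriv (Ω : Set (EuclideanSpace ℝ (Fin n))) (i : Fin n) : H10 Ω →L[ℝ] L2 Ω :=
  (PiLp.proj 2 (fun _ : Fin n => L2 Ω) i) ∘L
    (WithLp.sndL 2 ℝ (L2 Ω) (PiLp 2 (fun _ : Fin n => L2 Ω))) ∘L (H10 Ω).subtypeL

theorem IsTestFunction.continuous_partialDeriv {Ω : Set (EuclideanSpace ℝ (Fin n))}
    {φ : EuclideanSpace ℝ (Fin n) → ℝ} (h : IsTestFunction Ω φ) (i : Fin n) :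
    Continuous (partialDeriv i φ) :=
  (h.smooth.continuous_fderiv (by simp)).clm_apply continuous_const

theorem IsTestFunction.hasCompactSupport_partialDeriv {Ω : Set (EuclideanSpace ℝ (Fin n))}
    {φ : EuclideanSpace ℝ (Fin n) → ℝ} (h : IsTestFunction Ω φ) (i : Fin n) :
    HasCompactSupport (partialDeriv i φ) :=
  h.compact.fderiv_apply ℝ _

/-- The `i`-th component of the second entry of an element of `H¹₀(Ω)` is the `i`-th weak partial
derivative of its first entry. -/
theorem weakDeriv_spec {Ω : Set (EuclideanSpace ℝ (Fin n))} (y : H10 Ω) (i : Fin n)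
    {ψ : EuclideanSpace ℝ (Fin n) → ℝ} (hψ : IsTestFunction Ω ψ) :
    ∫ x in Ω, toL2 Ω y x * partialDeriv i ψ x = -∫ x in Ω, weakDeriv Ω i y x * ψ x := by
  have m0 : MemLp ψ 2 (volume.restrict Ω) :=
    hψ.smooth.continuous.memLp_of_hasCompactSupport hψ.compact
  have m1 : MemLp (partialDeriv i ψ) 2 (volume.restrict Ω) :=
    (hψ.continuous_partialDeriv i).memLp_of_hasCompactSupport (hψ.hasCompactSupport_partialDeriv i)
  have key : ∀ (f : L2 Ω) (g : EuclideanSpace ℝ (Fin n) → ℝ)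
      (hg : MemLp g 2 (volume.restrict Ω)),
      inner ℝ (hg.toLp g) f = ∫ x in Ω, f x * g x := by
    intro f g hg
    rw [L2.inner_def]
    refine integral_congr_ae ?_
    filter_upwards [hg.coeFn_toLp] with x hx
    simp [hx]
  rw [← key _ _ m0, ← key _ _ m1]
  suffices H : ∀ w ∈ closure (testPairs Ω : Set (Pairs Ω)),
      inner ℝ (m1.toLp _) w.fst + inner ℝ (m0.toLp _) (w.snd i) = 0 from
    eq_neg_of_add_eq_zero_left (H y.1 y.2)
  intro w hw
  refine closure_minimal (s := (testPairs Ω : Set (Pairs Ω))) (t := {w : Pairs Ω |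
    inner ℝ (m1.toLp _) w.fst + inner ℝ (m0.toLp _) (w.snd i) = 0}) ?_ ?_ hw
  · rintro v ⟨φ, hφ, h1, h2⟩
    change _ + _ = (0 : ℝ)
    rw [key _ _ m0, key _ _ m1]
    have e1 : ∫ x in Ω, v.fst x * partialDeriv i ψ x = ∫ x, φ x * partialDeriv i ψ x := by
      rw [integral_congr_ae (g := fun x => φ x * partialDeriv i ψ x)
        (by filter_upwards [h1] with x hx; rw [hx])]
      refine setIntegral_eq_integral_of_forall_compl_eq_zero fun x hx => ?_
      rw [image_eq_zero_of_notMem_tsupport fun h => hx (hφ.subset h), zero_mul]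
    have e2 : ∫ x in Ω, v.snd i x * ψ x = ∫ x, partialDeriv i φ x * ψ x := by
      rw [integral_congr_ae (g := fun x => partialDeriv i φ x * ψ x)
        (by filter_upwards [h2 i] with x hx; rw [hx])]
      refine setIntegral_eq_integral_of_forall_compl_eq_zero fun x hx => ?_
      rw [image_eq_zero_of_notMem_tsupport fun h => hx (hψ.subset h), mul_zero]
    rw [e1, e2]
    have := integral_mul_fderiv_eq_neg_fderiv_mul_of_integrable (μ := volume)
      (f := φ) (g := ψ) (v := EuclideanSpace.single i 1)
      (((hφ.continuous_partialDeriv i).mul hψ.smooth.continuous).integrable_of_hasCompactSupport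
        (hψ.compact.mul_left))
      ((hφ.smooth.continuous.mul (hψ.continuous_partialDeriv i)).integrable_of_hasCompactSupport
        (hφ.compact.mul_right))
      ((hφ.smooth.continuous.mul hψ.smooth.continuous).integrable_of_hasCompactSupport
        (hφ.compact.mul_right))
      (fun x _ => hφ.smooth.differentiable (by simp) x)
      (fun x _ => hψ.smooth.differentiable (by simp) x)
    simp only [partialDeriv]
    rw [this]
    ring
  · refine isClosed_eq ?_ continuous_const
    have c1 : Continuous fun w : Pairs Ω => w.fst :=
      (WithLp.fstL 2 ℝ (L2 Ω) (PiLp 2 (fun _ : Fin n => L2 Ω))).continuous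
    have c2 : Continuous fun w : Pairs Ω => w.snd i :=
      ((PiLp.proj 2 (fun _ : Fin n => L2 Ω) i) ∘L
        (WithLp.sndL 2 ℝ (L2 Ω) (PiLp 2 (fun _ : Fin n => L2 Ω)))).continuous
    exact (continuous_const.inner c1).add (continuous_const.inner c2)

/-- For open `Ω` an element of `H¹₀(Ω)` is determined by its underlying `L²`-function. -/
theorem toL2_injective {Ω : Set (EuclideanSpace ℝ (Fin n))} (hΩ : IsOpen Ω) :
    Function.Injective (toL2 Ω) := by
  rw [injective_iff_map_eq_zero]
  intro y hy
  have h : ∀ i, weakDeriv Ω i y = 0 := by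
    intro i
    have hae := hΩ.ae_eq_zero_of_integral_contDiff_smul_eq_zero (μ := volume.restrict Ω)
      (f := weakDeriv Ω i y)
      (((Lp.memLp (weakDeriv Ω i y)).locallyIntegrable (by norm_num)).locallyIntegrableOn Ω)
      (fun g h1 h2 h3 => by
        have h4 := weakDeriv_spec y i (ψ := g) ⟨h1, h2, h3⟩
        rw [hy, integral_congr_ae (g := fun _ => (0 : ℝ))
          (by filter_upwards [Lp.coeFn_zero ℝ 2 (volume.restrict Ω)] with x hx; rw [hx]; exact zero_mul _),
          integral_zero] at h4
        simp only [smul_eq_mul, mul_comm (g _)]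
        linarith)
    rw [Lp.eq_zero_iff_ae_eq_zero]
    filter_upwards [hae, ae_restrict_mem hΩ.measurableSet] with x hx hx'
    exact hx hx'
  refine Subtype.ext (WithLp.ofLp_injective 2 (Prod.ext hy (WithLp.ofLp_injective 2 (funext h))))

/-- Multiplication by a bounded function, `L²(Ω) → L²(Ω)`. -/
def mulOp {Ω : Set (EuclideanSpace ℝ (Fin n))} (c : Linf Ω) : L2 Ω →L[ℝ] L2 Ω :=
  (ContinuousLinearMap.mul ℝ ℝ).holderL (volume.restrict Ω) ∞ 2 2 c

/-- The bilinear form `a(y, v) = ∫_Ω ∑ᵢⱼ aᵢⱼ y_{xᵢ} v_{xⱼ} + c₀ y v dx` on `H¹₀(Ω)`. -/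
def bilinearForm {Ω : Set (EuclideanSpace ℝ (Fin n))}
    (A : Fin n → Fin n → Linf Ω) (c₀ : Linf Ω) (y v : H10 Ω) : ℝ :=
  ∫ x in Ω, (∑ i, ∑ j, A i j x * weakDeriv Ω i y x * weakDeriv Ω j v x) +
    c₀ x * toL2 Ω y x * toL2 Ω v x

/-- The operator `H¹₀(Ω) → H⁻¹(Ω)`, `y ↦ a(y, ·)` induced by the bilinear form; see
`stateOperator_apply`. -/
def stateOperator {Ω : Set (EuclideanSpace ℝ (Fin n))}
    (A : Fin n → Fin n → Linf Ω) (c₀ : Linf Ω) : H10 Ω →L[ℝ] Hm1 Ω :=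
  (∑ i, ∑ j, (innerSL ℝ : L2 Ω →L[ℝ] L2 Ω →L[ℝ] ℝ).bilinearComp
      (mulOp (A i j) ∘L weakDeriv Ω i) (weakDeriv Ω j)) +
    (innerSL ℝ : L2 Ω →L[ℝ] L2 Ω →L[ℝ] ℝ).bilinearComp (mulOp c₀ ∘L toL2 Ω) (toL2 Ω)

/-- The embedding `B : L²(Ω) → H⁻¹(Ω)`, `B f = (f, ·)_{L²(Ω)}`. -/
def toHm1 (Ω : Set (EuclideanSpace ℝ (Fin n))) : L2 Ω →L[ℝ] Hm1 Ω :=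
  (innerSL ℝ : L2 Ω →L[ℝ] L2 Ω →L[ℝ] ℝ).bilinearComp (.id ℝ (L2 Ω)) (toL2 Ω)

theorem toHm1_apply (Ω : Set (EuclideanSpace ℝ (Fin n))) (f : L2 Ω) (v : H10 Ω) :
    toHm1 Ω f v = inner ℝ f (toL2 Ω v) := rfl

theorem coeFn_mulOp {Ω : Set (EuclideanSpace ℝ (Fin n))} (c : Linf Ω) (f : L2 Ω) :
    mulOp c f =ᵐ[volume.restrict Ω] fun x => c x * f x :=
  (ContinuousLinearMap.mul ℝ ℝ).coeFn_holder c f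

theorem inner_mulOp {Ω : Set (EuclideanSpace ℝ (Fin n))} (c : Linf Ω) (f g : L2 Ω) :
    Integrable (fun x => c x * f x * g x) (volume.restrict Ω) ∧
      inner ℝ (mulOp c f) g = ∫ x in Ω, c x * f x * g x := by
  have h : (fun x => inner ℝ (mulOp c f x) (g x)) =ᵐ[volume.restrict Ω]
      fun x => c x * f x * g x := by
    filter_upwards [coeFn_mulOp c f] with x hx
    simp [hx, mul_comm]
  exact ⟨(L2.integrable_inner (𝕜 := ℝ) (mulOp c f) g).congr h,
    (L2.inner_def (𝕜 := ℝ) _ _).trans (integral_congr_ae h)⟩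

theorem stateOperator_apply {Ω : Set (EuclideanSpace ℝ (Fin n))}
    (A : Fin n → Fin n → Linf Ω) (c₀ : Linf Ω) (y v : H10 Ω) :
    stateOperator A c₀ y v = bilinearForm A c₀ y v := by
  rw [bilinearForm, integral_add (integrable_finsetSum _ fun i _ => integrable_finsetSum _
    fun j _ => (inner_mulOp _ _ _).1) (inner_mulOp _ _ _).1,
    integral_finsetSum _ fun i _ => integrable_finsetSum _ fun j _ => (inner_mulOp _ _ _).1]
  simp_rw [integral_finsetSum Finset.univ fun j _ =>
    (inner_mulOp (A _ j) (weakDeriv Ω _ y) (weakDeriv Ω j v)).1, ← (inner_mulOp _ _ _).2]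
  simp [stateOperator]

/-- The solution operator `S : H⁻¹(Ω) → H¹₀(Ω)`: the inverse of `y ↦ a(y, ·)`. -/
def solutionOperator {Ω : Set (EuclideanSpace ℝ (Fin n))}
    (A : Fin n → Fin n → Linf Ω) (c₀ : Linf Ω) : Hm1 Ω →L[ℝ] H10 Ω :=
  (stateOperator A c₀).inverse

/-- For a real Hilbert space `Y`, the adjoint `T* : Y* → Y** = Y` of a bounded operator
`T : Y* → Y`, characterized by `g (T* f) = f (T g)` for all `f, g ∈ Y*`. -/
def dualAdjoint {Y : Type*} [NormedAddCommGroup Y] [InnerProductSpace ℝ Y] [CompleteSpace Y]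
    (T : StrongDual ℝ Y →L[ℝ] Y) (f : StrongDual ℝ Y) : Y :=
  (InnerProductSpace.toDual ℝ Y).symm (f ∘L T ∘L (innerSL ℝ : Y →L[ℝ] StrongDual ℝ Y))

theorem dualAdjoint_spec {Y : Type*} [NormedAddCommGroup Y] [InnerProductSpace ℝ Y]
    [CompleteSpace Y] (T : StrongDual ℝ Y →L[ℝ] Y) (f g : StrongDual ℝ Y) :
    g (dualAdjoint T f) = f (T g) := by
  obtain ⟨w, rfl⟩ := (InnerProductSpace.toDual ℝ Y).surjective g
  rw [InnerProductSpace.toDual_apply_apply, real_inner_comm, dualAdjoint,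
    InnerProductSpace.toDual_symm_apply]
  rfl

/-- Uniform ellipticity of `L y = -∑ᵢⱼ ∂_{xⱼ}(aᵢⱼ y_{xᵢ}) + c₀ y`: symmetric coefficients,
`c₀ ≥ 0`, and `∑ᵢⱼ aᵢⱼ(x) ξᵢ ξⱼ ≥ θ ‖ξ‖²` for some constant `θ > 0`. -/
structure UniformlyElliptic {Ω : Set (EuclideanSpace ℝ (Fin n))}
    (A : Fin n → Fin n → Linf Ω) (c₀ : Linf Ω) : Prop where
  symm : ∀ i j, A i j =ᵐ[volume.restrict Ω] A j i
  nonneg : ∀ᵐ x ∂volume.restrict Ω, 0 ≤ c₀ x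
  elliptic : ∃ θ : ℝ, 0 < θ ∧ ∀ᵐ x ∂volume.restrict Ω, ∀ ξ : EuclideanSpace ℝ (Fin n),
    θ * ‖ξ‖ ^ 2 ≤ ∑ i, ∑ j, A i j x * ξ i * ξ j

/-- `U_ad = {u ∈ L²(Ω) | a ≤ u ≤ b a.e. on Ω}`. -/
def admissibleSet (Ω : Set (EuclideanSpace ℝ (Fin n))) (a b : ℝ) : Set (L2 Ω) :=
  {u | ∀ᵐ x ∂volume.restrict Ω, a ≤ u x ∧ u x ≤ b}

/-- `‖u‖_{L¹(Ω)}`. -/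
def normL1 {Ω : Set (EuclideanSpace ℝ (Fin n))} (u : L2 Ω) : ℝ := ∫ x in Ω, |u x|

/-- `J(y, u) = ½ ‖y - y_d‖² + (α/2) ‖u‖² + β ‖u‖_{L¹}`, the first two norms in `L²(Ω)`. -/
def cost {Ω : Set (EuclideanSpace ℝ (Fin n))} (α β : ℝ) (y_d : L2 Ω)
    (y : H10 Ω) (u : L2 Ω) : ℝ :=
  1 / 2 * ‖toL2 Ω y - y_d‖ ^ 2 + α / 2 * ‖u‖ ^ 2 + β * normL1 u

/-- `y ∈ H¹₀(Ω)` is a weak solution of `L y = f` in `Ω`, `y = 0` on `∂Ω`. -/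
def IsWeakSolution {Ω : Set (EuclideanSpace ℝ (Fin n))}
    (A : Fin n → Fin n → Linf Ω) (c₀ : Linf Ω) (f : L2 Ω) (y : H10 Ω) : Prop :=
  ∀ v : H10 Ω, bilinearForm A c₀ y v = inner ℝ f (toL2 Ω v)

/-- The feasible set of the control problem. -/
def feasibleSet {Ω : Set (EuclideanSpace ℝ (Fin n))} (A : Fin n → Fin n → Linf Ω)
    (c₀ : Linf Ω) (a b : ℝ) (y_r : L2 Ω) : Set (H10 Ω × L2 Ω) :=
  {z | IsWeakSolution A c₀ (z.2 + y_r) z.1 ∧ z.2 ∈ admissibleSet Ω a b}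

/-- `(y, u)` is an optimal solution of the control problem. -/
def IsOptimal {Ω : Set (EuclideanSpace ℝ (Fin n))} (A : Fin n → Fin n → Linf Ω)
    (c₀ : Linf Ω) (a b α β : ℝ) (y_d y_r : L2 Ω) (y : H10 Ω) (u : L2 Ω) : Prop :=
  (y, u) ∈ feasibleSet A c₀ a b y_r ∧
    ∀ z ∈ feasibleSet A c₀ a b y_r, cost α β y_d y u ≤ cost α β y_d z.1 z.2

end EllipticControl

end

/-! Invertibility is Lax–Milgram: ellipticity bounds `a(y, y)` below by the squared gradient norm,
and the Poincaré inequality `norm_toL2_le_weakDeriv` turns this into coercivity in the full norm of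
`H10 Ω`. Eliminating the state then leaves a problem in `u` alone: minimize a convex quadratic plus
the convex nonsmooth term `β • normL1` over a convex set. By `forall_le_quadratic_add_iff`,
minimality is equivalent to a variational inequality in which only the quadratic part is
differentiated. The adjoint state represents the derivative of the tracking term: `(p, v - u) = -(y
- y_d, T (v - u))` in `L²`, with `T` the linear control-to-state map. -/

/-! ### Coercivity and invertibility of the state operator -/

open EllipticControl in
/-- Poincaré's inequality on a bounded open set, with any one of the weak derivatives. -/
theorem EllipticControl.norm_toL2_le_weakDeriv {n : ℕ} {Ω : Set (EuclideanSpace ℝ (Fin n))}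
    (hΩ : IsOpen Ω) {R : ℝ} (hR : ∀ x ∈ Ω, ‖x‖ ≤ R) (i : Fin n) (y : H10 Ω) :
    ‖toL2 Ω y‖ ≤ 2 * R * ‖weakDeriv Ω i y‖ := by
  have c1 : Continuous fun w : Pairs Ω => w.fst :=
    (WithLp.fstL 2 ℝ (L2 Ω) (PiLp 2 (fun _ : Fin n => L2 Ω))).continuous
  have c2 : Continuous fun w : Pairs Ω => w.snd i :=
    ((PiLp.proj 2 (fun _ : Fin n => L2 Ω) i) ∘L
      (WithLp.sndL 2 ℝ (L2 Ω) (PiLp 2 (fun _ : Fin n => L2 Ω)))).continuous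
  refine closure_minimal (s := (testPairs Ω : Set (Pairs Ω)))
    (t := {w : Pairs Ω | ‖w.fst‖ ≤ 2 * R * ‖w.snd i‖}) ?_
    (isClosed_le c1.norm (continuous_const.mul c2.norm)) y.2
  intro w hw
  obtain ⟨φ, hφ, h1, h2⟩ := hw
  let w' : H10 Ω := ⟨w, (testPairs Ω).le_topologicalClosure ⟨φ, hφ, h1, h2⟩⟩
  have hcoord : ContDiff ℝ ∞ fun x : EuclideanSpace ℝ (Fin n) => x i :=
    (EuclideanSpace.proj (𝕜 := ℝ) i).contDiff
  -- Testing the weak derivative of `φ` against `x i * φ` gives `‖φ‖² = -2 ∫ x i * φ * ∂ᵢφ`.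
  -- Cauchy–Schwarz and `|x i| ≤ R` then yield the constant `2 * R`.
  have hψ : IsTestFunction Ω fun x => x i * φ x :=
    ⟨hcoord.mul hφ.smooth, hφ.compact.mul_left, (closure_mono
      (Function.support_mul_subset_right _ _)).trans hφ.subset⟩
  have hder : ∀ x, partialDeriv i (fun x => x i * φ x) x = φ x + x i * partialDeriv i φ x := by
    intro x
    have h := ((EuclideanSpace.proj (𝕜 := ℝ) i).hasFDerivAt (x := x)).mul
      (hφ.smooth.differentiable (by simp) x).hasFDerivAt
    have h' : fderiv ℝ (fun x => x i * φ x) x = _ := h.fderiv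
    simp only [partialDeriv, h']
    simp
    ring
  have hs := weakDeriv_spec w' i hψ
  have e0 : toL2 Ω w' = w.fst := rfl
  have e1 : weakDeriv Ω i w' = w.snd i := rfl
  rw [e0, e1] at hs
  have hb : ∀ᵐ x ∂volume.restrict Ω, ‖x i * w.fst x‖ ≤ R * ‖w.fst x‖ := by
    filter_upwards [ae_restrict_mem hΩ.measurableSet] with x hx
    rw [norm_mul]
    exact mul_le_mul_of_nonneg_right ((PiLp.norm_apply_le x i).trans (hR x hx)) (norm_nonneg _)
  have hm : MemLp (fun x => x i * w.fst x) 2 (volume.restrict Ω) :=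
    (Lp.memLp w.fst).of_le_mul
      (hcoord.continuous.aestronglyMeasurable.mul (Lp.aestronglyMeasurable _)) hb
  have hk : ‖hm.toLp _‖ ≤ R * ‖w.fst‖ := by
    refine Lp.norm_le_mul_norm_of_ae_le_mul ?_
    filter_upwards [hm.coeFn_toLp, hb] with x hx hx'
    rwa [hx]
  have i1 : Integrable (fun x => w.fst x * w.fst x) (volume.restrict Ω) :=
    (L2.integrable_inner (𝕜 := ℝ) w.fst w.fst).congr (by simp [sq])
  have i2e : (fun x => inner ℝ (hm.toLp _ x) (w.snd i x)) =ᵐ[volume.restrict Ω]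
      fun x => x i * w.fst x * w.snd i x := by
    filter_upwards [hm.coeFn_toLp] with x hx
    simp [hx, mul_comm]
  have i2 := (L2.integrable_inner (𝕜 := ℝ) (hm.toLp _) (w.snd i)).congr i2e
  have f1 : ∫ x in Ω, w.fst x * partialDeriv i (fun x => x i * φ x) x =
      ‖w.fst‖ ^ 2 + inner ℝ (hm.toLp _) (w.snd i) := by
    rw [← real_inner_self_eq_norm_sq, L2.inner_def, L2.inner_def, integral_congr_ae i2e,
      ← integral_add (L2.integrable_inner _ _) i2]
    refine integral_congr_ae ?_
    filter_upwards [h1, h2 i] with x hx hx'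
    rw [hder, ← hx, ← hx']
    simp
    ring
  have f2 : ∫ x in Ω, w.snd i x * (x i * φ x) = inner ℝ (hm.toLp _) (w.snd i) := by
    rw [L2.inner_def, integral_congr_ae i2e]
    refine integral_congr_ae ?_
    filter_upwards [h1] with x hx
    rw [← hx]
    ring
  rw [f1, f2] at hs
  have hcs := (abs_le.1 (abs_real_inner_le_norm (hm.toLp _) (w.snd i))).1
  have hk' := mul_le_mul_of_nonneg_right hk (norm_nonneg (w.snd i))
  change ‖w.fst‖ ≤ 2 * R * ‖w.snd i‖
  -- The estimate obtained is `‖φ‖² ≤ 2R ‖φ‖ ‖∂ᵢφ‖`, so cancelling a factor needs `‖φ‖ > 0`.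
  rcases (norm_nonneg w.fst).eq_or_lt with h | h
  · have hz : φ =ᵐ[volume.restrict Ω] 0 := by
      have : w.fst = 0 := norm_eq_zero.1 h.symm
      rw [this] at h1
      exact h1.symm.trans (Lp.coeFn_zero _ _ _)
    -- `R` can be negative only when `Ω` is empty, and then every `L²` class vanishes.
    rcases Ω.eq_empty_or_nonempty with rfl | ⟨x, hx⟩
    · have : w.snd i = 0 := by
        rw [Lp.eq_zero_iff_ae_eq_zero]
        simp [Filter.EventuallyEq]
      rw [← h, this]
      simp
    · have hR0 : 0 ≤ R := (norm_nonneg x).trans (hR x hx)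
      rw [← h]
      positivity
  · refine le_of_mul_le_mul_left ?_ h
    nlinarith

-- Ellipticity is applied pointwise with `ξ = ∇y(x)`; the zeroth-order term is nonnegative and is
-- dropped.
open EllipticControl in
theorem EllipticControl.le_bilinearForm_self {n : ℕ} {Ω : Set (EuclideanSpace ℝ (Fin n))}
    {A : Fin n → Fin n → Linf Ω} {c₀ : Linf Ω} (hc : ∀ᵐ x ∂volume.restrict Ω, 0 ≤ c₀ x) {θ : ℝ}
    (hA : ∀ᵐ x ∂volume.restrict Ω, ∀ ξ : EuclideanSpace ℝ (Fin n),
      θ * ‖ξ‖ ^ 2 ≤ ∑ i, ∑ j, A i j x * ξ i * ξ j) (y : H10 Ω) :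
    θ * ∑ i, ‖weakDeriv Ω i y‖ ^ 2 ≤ bilinearForm A c₀ y y := by
  have e : ∀ f : L2 Ω, Integrable (fun x => f x ^ 2) (volume.restrict Ω) ∧
      ‖f‖ ^ 2 = ∫ x in Ω, f x ^ 2 := by
    intro f
    have h : (fun x => inner ℝ (f x) (f x)) = fun x => f x ^ 2 := by
      funext x
      simp
    rw [← real_inner_self_eq_norm_sq, L2.inner_def, h]
    exact ⟨h ▸ L2.integrable_inner (𝕜 := ℝ) f f, rfl⟩
  simp_rw [fun i => (e (weakDeriv Ω i y)).2]
  rw [← integral_finsetSum _ fun i _ => (e _).1, ← integral_const_mul, bilinearForm]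
  refine integral_mono_ae ((integrable_finsetSum _ fun i _ => (e _).1).const_mul _)
    ((integrable_finsetSum _ fun i _ => integrable_finsetSum _
      fun j _ => (inner_mulOp _ _ _).1).add (inner_mulOp _ _ _).1) ?_
  filter_upwards [hc, hA] with x hx hx'
  have h := hx' (WithLp.toLp 2 fun i => weakDeriv Ω i y x)
  rw [EuclideanSpace.norm_sq_eq] at h
  simp only [Real.norm_eq_abs, sq_abs] at h
  have h0 : 0 ≤ c₀ x * toL2 Ω y x * toL2 Ω y x := by
    rw [mul_assoc]
    exact mul_nonneg hx (mul_self_nonneg _)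
  exact h.trans (le_add_of_nonneg_right h0)

open EllipticControl in
theorem EllipticControl.norm_sq_eq {n : ℕ} {Ω : Set (EuclideanSpace ℝ (Fin n))} (y : H10 Ω) :
    ‖y‖ ^ 2 = ‖toL2 Ω y‖ ^ 2 + ∑ i, ‖weakDeriv Ω i y‖ ^ 2 := by
  rw [Submodule.coe_norm, WithLp.prod_norm_sq_eq_of_L2, PiLp.norm_sq_eq_of_L2]
  rfl

/-- The Lax–Milgram theorem, as a statement on the induced operator into the dual space. -/
theorem IsCoercive.isInvertible {Y : Type*} [NormedAddCommGroup Y] [InnerProductSpace ℝ Y]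
    [CompleteSpace Y] {B : Y →L[ℝ] StrongDual ℝ Y} (hB : IsCoercive B) : B.IsInvertible := by
  refine ⟨hB.continuousLinearEquivOfBilin.trans
    (InnerProductSpace.toDual ℝ Y).toContinuousLinearEquiv, ?_⟩
  ext y v
  exact hB.continuousLinearEquivOfBilin_apply y v

open EllipticControl in
theorem EllipticControl.UniformlyElliptic.coercive {n : ℕ} (hn : 0 < n)
    {Ω : Set (EuclideanSpace ℝ (Fin n))} (hΩ : IsOpen Ω) (hΩb : Bornology.IsBounded Ω)
    {A : Fin n → Fin n → Linf Ω} {c₀ : Linf Ω} (hA : UniformlyElliptic A c₀) :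
    ∃ C : ℝ, 0 < C ∧ ∀ y : H10 Ω, C * ‖y‖ * ‖y‖ ≤ bilinearForm A c₀ y y := by
  obtain ⟨R, hR⟩ := hΩb.exists_norm_le
  obtain ⟨θ, hθ, hell⟩ := hA.elliptic
  -- Squaring Poincaré in one direction, available since `0 < n`, gives `‖y‖² ≤ (4R² + 1) ∑ i,
  -- ‖∂ᵢy‖²`.
  refine ⟨θ / (4 * R ^ 2 + 1), by positivity, fun y => ?_⟩
  refine le_trans ?_ (le_bilinearForm_self hA.nonneg hell y)
  have hp := pow_le_pow_left₀ (norm_nonneg _) (norm_toL2_le_weakDeriv hΩ hR ⟨0, hn⟩ y) 2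
  have hs := Finset.single_le_sum (f := fun i => ‖weakDeriv Ω i y‖ ^ 2)
    (fun i _ => sq_nonneg _) (Finset.mem_univ ⟨0, hn⟩)
  rw [mul_assoc, ← sq, norm_sq_eq, div_mul_eq_mul_div, mul_div_assoc]
  refine mul_le_mul_of_nonneg_left ?_ hθ.le
  rw [div_le_iff₀ (by positivity)]
  have := mul_le_mul_of_nonneg_left hs (show 0 ≤ 4 * R ^ 2 by positivity)
  nlinarith

open EllipticControl in
/-- The operator `y ↦ a(y, ·)` of a uniformly elliptic form is invertible. -/
theorem EllipticControl.UniformlyElliptic.isInvertible_stateOperator {n : ℕ} (hn : 0 < n)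
    {Ω : Set (EuclideanSpace ℝ (Fin n))} (hΩ : IsOpen Ω) (hΩb : Bornology.IsBounded Ω)
    {A : Fin n → Fin n → Linf Ω} {c₀ : Linf Ω} (hA : UniformlyElliptic A c₀) :
    (stateOperator A c₀).IsInvertible := by
  obtain ⟨C, hC, h⟩ := hA.coercive hn hΩ hΩb
  exact IsCoercive.isInvertible (Y := H10 Ω) (B := stateOperator A c₀)
    ⟨C, hC, fun y => (h y).trans_eq (stateOperator_apply A c₀ y y).symm⟩

/-! ### Variational inequality for a quadratic plus a convex function -/

/-- First-order characterization of the minimizers over a convex set of a linear-quadratic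
function plus a convex function. -/
theorem forall_le_quadratic_add_iff {H K : Type*} [NormedAddCommGroup H] [InnerProductSpace ℝ H]
    [NormedAddCommGroup K] [InnerProductSpace ℝ K] (T : H →L[ℝ] K) (z : K) {α : ℝ} (hα : 0 ≤ α)
    {s : Set H} {N : H → ℝ} (hN : ConvexOn ℝ s N) {u : H} (hu : u ∈ s) :
    (∀ v ∈ s, 1 / 2 * ‖T u + z‖ ^ 2 + α / 2 * ‖u‖ ^ 2 + N u ≤
        1 / 2 * ‖T v + z‖ ^ 2 + α / 2 * ‖v‖ ^ 2 + N v) ↔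
      ∀ v ∈ s, 0 ≤ inner ℝ (T u + z) (T (v - u)) + α * inner ℝ u (v - u) + (N v - N u) := by
  have expand : ∀ w : H, ∀ t : ℝ, 1 / 2 * ‖T (u + t • w) + z‖ ^ 2 + α / 2 * ‖u + t • w‖ ^ 2 =
      1 / 2 * ‖T u + z‖ ^ 2 + α / 2 * ‖u‖ ^ 2 +
        t * (inner ℝ (T u + z) (T w) + α * inner ℝ u w) +
        t ^ 2 * (1 / 2 * ‖T w‖ ^ 2 + α / 2 * ‖w‖ ^ 2) := by
    intro w t
    rw [map_add, map_smul, add_right_comm, norm_add_sq_real (T u + z), norm_add_sq_real u, inner_smul_right,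
      inner_smul_right, norm_smul, norm_smul, mul_pow, mul_pow, Real.norm_eq_abs, sq_abs]
    ring
  constructor
  · intro h v hv
    set D := inner ℝ (T u + z) (T (v - u)) + α * inner ℝ u (v - u) + (N v - N u) with hD
    set Q := 1 / 2 * ‖T (v - u)‖ ^ 2 + α / 2 * ‖v - u‖ ^ 2 with hQ
    -- Compare `u` with `u + t • (v - u)`. Convexity bounds the increment of `N` by `t * (N v - N
    -- u)`, so no derivative of `N` is needed; dividing by `t` and letting `t → 0⁺` leaves `D`.
    have key : ∀ t ∈ Set.Ioo (0 : ℝ) 1, 0 ≤ D + t * Q := by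
      intro t ht
      have hw : u + t • (v - u) = (1 - t) • u + t • v := by module
      have h1 := h _ (hw ▸ hN.1 hu hv (sub_nonneg.2 ht.2.le) ht.1.le (by ring))
      have h2 := hN.2 hu hv (sub_nonneg.2 ht.2.le) ht.1.le (by ring)
      rw [← hw, smul_eq_mul, smul_eq_mul] at h2
      rw [expand] at h1
      refine nonneg_of_mul_nonneg_right (b := D + t * Q) (a := t) ?_ ht.1
      rw [hD, hQ]
      nlinarith
    have hlim : Filter.Tendsto (fun t : ℝ => D + t * Q) (nhdsWithin 0 (Set.Ioi 0)) (nhds D) := by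
      have : Continuous fun t : ℝ => D + t * Q := by fun_prop
      simpa using (this.tendsto 0).mono_left nhdsWithin_le_nhds
    exact ge_of_tendsto hlim (Filter.mem_of_superset (Ioo_mem_nhdsGT one_pos) key)
  · intro h v hv
    have h1 := h v hv
    -- At `t = 1` the expansion is exact, and its second-order remainder is nonnegative.
    have h2 := expand (v - u) 1
    rw [one_smul, add_sub_cancel] at h2
    have h3 : 0 ≤ 1 / 2 * ‖T (v - u)‖ ^ 2 + α / 2 * ‖v - u‖ ^ 2 := by positivity
    rw [h2]
    linarith

/-! ### The reduced control problem -/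

open EllipticControl in
theorem EllipticControl.convex_admissibleSet {n : ℕ} (Ω : Set (EuclideanSpace ℝ (Fin n)))
    (a b : ℝ) : Convex ℝ (admissibleSet Ω a b) := by
  intro u hu v hv s t hs ht hst
  change ∀ᵐ x ∂volume.restrict Ω, _
  filter_upwards [hu, hv, Lp.coeFn_add (s • u) (t • v), Lp.coeFn_smul s u, Lp.coeFn_smul t v]
    with x h1 h2 h3 h4 h5
  rw [h3, Pi.add_apply, h4, h5]
  exact convex_Icc a b h1 h2 hs ht hst

open EllipticControl in
theorem EllipticControl.convexOn_normL1 {n : ℕ} {Ω : Set (EuclideanSpace ℝ (Fin n))}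
    (hΩ : Bornology.IsBounded Ω) : ConvexOn ℝ Set.univ (normL1 : L2 Ω → ℝ) := by
  refine ⟨convex_univ, fun u _ v _ s t hs ht hst => ?_⟩
  -- Finite measure puts `L²` inside `L¹`, so the integral in `normL1` is never the default value
  -- `0`.
  have : IsFiniteMeasure (volume.restrict Ω) :=
    isFiniteMeasure_restrict.2 hΩ.measure_lt_top.ne
  have hi : ∀ w : L2 Ω, Integrable (fun x => |w x|) (volume.restrict Ω) := fun w =>
    ((Lp.memLp w).integrable one_le_two).abs
  simp only [normL1, smul_eq_mul]
  rw [← integral_const_mul, ← integral_const_mul,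
    ← integral_add ((hi u).const_mul s) ((hi v).const_mul t)]
  refine integral_mono_ae (hi _) (((hi u).const_mul s).add ((hi v).const_mul t)) ?_
  filter_upwards [Lp.coeFn_add (s • u) (t • v), Lp.coeFn_smul s u, Lp.coeFn_smul t v]
    with x h3 h4 h5
  rw [h3, Pi.add_apply, h4, h5]
  refine (abs_add_le _ _).trans_eq ?_
  simp [abs_mul, abs_of_nonneg hs, abs_of_nonneg ht]

open EllipticControl in
theorem EllipticControl.isWeakSolution_iff {n : ℕ} {Ω : Set (EuclideanSpace ℝ (Fin n))}
    {A : Fin n → Fin n → Linf Ω} {c₀ : Linf Ω} (h : (stateOperator A c₀).IsInvertible)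
    (f : L2 Ω) (y : H10 Ω) :
    IsWeakSolution A c₀ f y ↔ y = solutionOperator A c₀ (toHm1 Ω f) := by
  have h1 : IsWeakSolution A c₀ f y ↔ stateOperator A c₀ y = toHm1 Ω f := by
    rw [ContinuousLinearMap.ext_iff]
    simp only [stateOperator_apply, toHm1_apply]
    rfl
  rw [h1]
  -- `inverse` is a true inverse only for invertible operators and is `0` otherwise.
  obtain ⟨M, hM⟩ := h
  rw [solutionOperator, ← hM, ContinuousLinearMap.inverse_equiv]
  exact M.eq_symm_apply.symm

open EllipticControl in
theorem theorem2p2 {n : ℕ} (hn : 0 < n) (Ω : Set (EuclideanSpace ℝ (Fin n)))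
    (hΩ : IsOpen Ω) (hΩb : Bornology.IsBounded Ω)
    (A : Fin n → Fin n → Linf Ω) (c₀ : Linf Ω) (hA : UniformlyElliptic A c₀)
    (a b α β : ℝ) (ha : a ≤ 0) (hb : 0 ≤ b) (hα : 0 < α) (hβ : 0 < β)
    (y_d y_r : L2 Ω) :
    (stateOperator A c₀).IsInvertible ∧
    ∀ (y : H10 Ω) (u : L2 Ω),
      IsOptimal A c₀ a b α β y_d y_r y u ↔
        u ∈ admissibleSet Ω a b ∧
        ∃ p : H10 Ω,
          y = solutionOperator A c₀ (toHm1 Ω (u + y_r)) ∧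
          p = dualAdjoint (solutionOperator A c₀) (toHm1 Ω (y_d - toL2 Ω y)) ∧
          ∀ v ∈ admissibleSet Ω a b,
            0 ≤ inner ℝ (α • u - toL2 Ω p) (v - u) + β * (normL1 v - normL1 u) := by

  have hinv := hA.isInvertible_stateOperator hn hΩ hΩb
  refine ⟨hinv, fun y u => ?_⟩
  -- The linear part of the control-to-state map; the source `y_r` goes into the constant shift `T
  -- y_r - y_d`.
  set T : L2 Ω →L[ℝ] L2 Ω := toL2 Ω ∘L solutionOperator A c₀ ∘L toHm1 Ω with hT
  have hcost : ∀ w : L2 Ω, cost α β y_d (solutionOperator A c₀ (toHm1 Ω (w + y_r))) w =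
      1 / 2 * ‖T w + (T y_r - y_d)‖ ^ 2 + α / 2 * ‖w‖ ^ 2 + (β • normL1) w := by
    intro w
    have : toL2 Ω (solutionOperator A c₀ (toHm1 Ω (w + y_r))) = T w + T y_r := by
      rw [← map_add]
      rfl
    rw [cost, this, add_sub_assoc]
    rfl
  have hconv : ConvexOn ℝ (admissibleSet Ω a b) (β • normL1 : L2 Ω → ℝ) :=
    ((convexOn_normL1 hΩb).subset (Set.subset_univ _) (convex_admissibleSet Ω a b)).smul hβ.le
  have hopt : IsOptimal A c₀ a b α β y_d y_r y u ↔ u ∈ admissibleSet Ω a b ∧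
      y = solutionOperator A c₀ (toHm1 Ω (u + y_r)) ∧
      ∀ v ∈ admissibleSet Ω a b, cost α β y_d y u ≤
        cost α β y_d (solutionOperator A c₀ (toHm1 Ω (v + y_r))) v := by
    constructor
    · rintro ⟨⟨h1, h2⟩, h3⟩
      exact ⟨h2, (isWeakSolution_iff hinv _ _).1 h1, fun v hv =>
        h3 (_, v) ⟨(isWeakSolution_iff hinv _ _).2 rfl, hv⟩⟩
    · rintro ⟨h2, h1, h3⟩
      refine ⟨⟨(isWeakSolution_iff hinv _ _).2 h1, h2⟩, ?_⟩
      rintro ⟨w, v⟩ ⟨hw, hv⟩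
      have hw' : w = _ := (isWeakSolution_iff hinv _ _).1 hw
      rw [hw']
      exact h3 v hv
  rw [hopt]
  refine and_congr_right fun hu => ?_
  -- The adjoint equation determines `p`, so the existential disappears.
  simp only [exists_and_left, exists_eq_left]
  refine and_congr_right fun hy => ?_
  subst hy
  simp_rw [hcost]
  rw [forall_le_quadratic_add_iff T _ hα.le hconv hu]
  refine forall₂_congr fun v _ => ?_
  -- The adjoint identity with `f = y_d - y` and `g = v - u`, both embedded in `Hm1 Ω`. The minus
  -- sign comes from `y_d - y` in place of the residual `y - y_d`.
  have hadj : inner ℝ (toL2 Ω (dualAdjoint (solutionOperator A c₀)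
        (toHm1 Ω (y_d - toL2 Ω (solutionOperator A c₀ (toHm1 Ω (u + y_r))))))) (v - u) =
      -inner ℝ (T u + (T y_r - y_d)) (T (v - u)) := by
    rw [real_inner_comm, ← toHm1_apply]
    refine (dualAdjoint_spec (Y := H10 Ω) _ _ _).trans ?_
    rw [toHm1_apply, ← inner_neg_left]
    congr 1
    have : toL2 Ω (solutionOperator A c₀ (toHm1 Ω (u + y_r))) = T u + T y_r := by
      rw [← map_add]
      rfl
    rw [this]
    abel
  rw [inner_sub_left, inner_smul_left, hadj, conj_trivial]
  simp only [Pi.smul_apply, smul_eq_mul]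
  ring_nf
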